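/- Let $R$ be a commutative ring (for instance $R=\mathbb{C}$), let $n\ge 2$ and $k\ge 0$ be integers, and let $R[S_n]$ be the group algebra of the symmetric group on $[n]=\{1,\dots,n\}$. For $1\le i\le n$ let $$J_i=\sum_{1\le j<i}(j\;i)\in R[S_n]$$ be the Jucys–Murphy elements (so $J_1=0$); they commute with each other, and for a symmetric polynomial $f$ in $n$ variables we write $f(\Xi_n)=f(J_1,\dots,J_n)$. Let $p_m,h_m,e_m$ be the power sum, complete homogeneous and elementary symmetric polynomials. Let $T_n$ be the transitivity operator: it is the $R$-linear map defined on formal products of permutations by $$T_n(\tau_1\tau_2\cdots\tau_t)=\begin{cases}\tau_1\tau_2\cdots\tau_t\in R[S_n], & \text{if the group generated by }\tau_1,\dots,\tau_t\text{ acts transitively on }[n],\\ 0,&\text{otherwise.}\end{cases}$$ For an expression that is a polynomial in the $J_i$, $T_n$ is applied after replacing every $J_i$ by its defining sum of transpositions and multiplying out formally, i.e. without carrying out the products in $S_n$ (the result does not depend on the order in which the factors $J_i$ of a monomial are written). Then $$T_n\big(p_{n-1+k}(\Xi_n)\big)=T_n\big(J_n^{\,n-1+k}\big)=J_2J_3\cdots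 J_n\cdot h_k(\Xi_n)=e_{n-1}(\Xi_n)\cdot h_k(\Xi_n).$$ -/

import Mathlib

/-!
Jucys-Murphy elements, evaluation of symmetric functions at them, and the transitivity operator.

The set `{1, …, n}` is modelled by `Fin n`; the symbol `k` is the element of `Fin n`
with value `k - 1`, so that the `k`-th Jucys-Murphy element `J_k` is `jm R ⟨k - 1, _⟩`.  The coefficient ring `R` is an arbitrary commutative ring.
-/

namespace JucysMurphy

noncomputable section

open Equiv

/-- The group algebra of the symmetric group on `Fin n`. -/
abbrev GroupAlg (R : Type*) [CommRing R] (n : ℕ) : Type _ :=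
  MonoidAlgebra R (Perm (Fin n))

/-- Formal linear combinations of words (finite sequences) of permutations: the formal "sums of
products of permutations" in which the individual factors are remembered. -/
abbrev WordAlg (R : Type*) [CommRing R] (n : ℕ) : Type _ :=
  MonoidAlgebra R (FreeMonoid (Perm (Fin n)))

/-- The Jucys-Murphy element at `i`: the sum of the transpositions `(j i)` over all `j < i`.
It is `0` when `i` is the first symbol. -/
def jm (R : Type*) [CommRing R] {n : ℕ} (i : Fin n) : GroupAlg R n :=
  ∑ j ∈ Finset.univ.filter (fun j : Fin n => j < i), MonoidAlgebra.of R _ (swap j i)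

/-- The Jucys-Murphy element at `i` as a formal sum of one-letter words. -/
def wordJM (R : Type*) [CommRing R] {n : ℕ} (i : Fin n) : WordAlg R n :=
  ∑ j ∈ Finset.univ.filter (fun j : Fin n => j < i),
    MonoidAlgebra.of R _ (FreeMonoid.of (swap j i))

/-- The subgroup generated by a set of permutations has a single orbit on `Fin n`. -/
def ActsTransitively {n : ℕ} (S : Set (Perm (Fin n))) : Prop :=
  MulAction.IsPretransitive (Subgroup.closure S) (Fin n)

open Classical in
/-- The transitivity operator: the linear map that sends a word `τ₁ τ₂ ⋯ τₜ` to the product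
`τ₁ τ₂ ⋯ τₜ` in the group algebra if `{τ₁, …, τₜ}` acts transitively, and to `0` otherwise. -/
def transOp (R : Type*) [CommRing R] (n : ℕ) : WordAlg R n →ₗ[R] GroupAlg R n where
  toFun x := x.coeff.sum fun w c =>
    if ActsTransitively {τ | τ ∈ w.toList} then MonoidAlgebra.single w.toList.prod c else 0
  map_add' x y := by
    rw [MonoidAlgebra.coeff_add]
    refine Finsupp.sum_add_index' (fun w => by simp) (fun w a b => ?_)
    split_ifs <;> simp
  map_smul' r x := by
    rw [MonoidAlgebra.coeff_smul, Finsupp.sum_smul_index' (fun w => by simp), Finsupp.smul_sum]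
    refine Finsupp.sum_congr fun w _ => ?_
    split_ifs <;> simp

open Classical in
theorem transOp_of (R : Type*) [CommRing R] {n : ℕ} (w : FreeMonoid (Perm (Fin n))) :
    transOp R n (MonoidAlgebra.of R _ w) =
      if ActsTransitively {τ | τ ∈ w.toList} then MonoidAlgebra.of R _ w.toList.prod else 0 := by
  simp only [transOp, LinearMap.coe_mk, AddHom.coe_mk, MonoidAlgebra.of_apply,
    MonoidAlgebra.coeff_single]
  rw [Finsupp.sum_single_index (by simp)]

/-- The expansion of a polynomial in the Jucys-Murphy elements as a formal sum of words:
each variable `X i` is replaced by `wordJM R i`, in every monomial the factors are multiplied in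
increasing order of the index, and everything is multiplied out.  (By
`transOp_mul_wordJM_comm` the order of the factors is irrelevant for the transitivity operator.) -/
def wordExpand (R : Type*) [CommRing R] {n : ℕ} (f : MvPolynomial (Fin n) R) : WordAlg R n :=
  ∑ m ∈ f.support, f.coeff m • (List.ofFn fun i : Fin n => wordJM R i ^ m i).prod

/-- The transitive image of the polynomial `f` evaluated at the Jucys-Murphy elements: multiply
out, then keep only the products whose factors act transitively. -/
def transEval (R : Type*) [CommRing R] {n : ℕ} (f : MvPolynomial (Fin n) R) : GroupAlg R n :=
  transOp R n (wordExpand R f)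

theorem swap_mul_jm {R : Type*} [CommRing R] {n : ℕ} {a i j : Fin n} (ha : a < i) (hij : i < j) :
    MonoidAlgebra.of R _ (swap a i) * jm R j = jm R j * MonoidAlgebra.of R _ (swap a i) := by
  simp only [jm, Finset.mul_sum, Finset.sum_mul, ← map_mul]
  refine Finset.sum_equiv (swap a i) (fun b => ?_) (fun b _ => ?_)
  · simp only [Finset.mem_filter, Finset.mem_univ, true_and]
    by_cases h1 : b = a
    · subst h1; simp [hij, ha.trans hij]
    by_cases h2 : b = i
    · subst h2; simp [hij, ha.trans hij]
    rw [swap_apply_of_ne_of_ne h1 h2]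
  · congr 1
    have h := Equiv.swap_apply_apply (swap a i) b j
    rw [swap_apply_of_ne_of_ne (ha.trans hij).ne' hij.ne'] at h
    rw [h]; simp [mul_assoc]

theorem jm_comm (R : Type*) [CommRing R] {n : ℕ} (i j : Fin n) :
    jm R i * jm R j = jm R j * jm R i := by
  have key : ∀ i j : Fin n, i < j → jm R i * jm R j = jm R j * jm R i := by
    intro i j hij
    conv_lhs => rw [jm]
    conv_rhs => rw [jm.eq_1 R i]
    rw [Finset.sum_mul, Finset.mul_sum]
    refine Finset.sum_congr rfl fun a ha => ?_
    exact swap_mul_jm (by simpa using ha) hij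
  rcases lt_trichotomy i j with h | h | h
  · exact key i j h
  · rw [h]
  · exact (key j i h).symm

/-- The commutative subalgebra generated by the Jucys-Murphy elements. -/
def jmAlg (R : Type*) [CommRing R] (n : ℕ) : Subalgebra R (GroupAlg R n) :=
  Algebra.adjoin R (Set.range (jm R (n := n)))

instance (R : Type*) [CommRing R] (n : ℕ) : IsMulCommutative (jmAlg R n) :=
  Algebra.isMulCommutative_adjoin R (by
    rintro _ ⟨i, rfl⟩ _ ⟨j, rfl⟩
    exact jm_comm R i j)

open scoped IsMulCommutative in
/-- Evaluation of a polynomial at the (commuting) Jucys-Murphy elements, `X i ↦ jm R i`. -/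
def jmEval (R : Type*) [CommRing R] (n : ℕ) : MvPolynomial (Fin n) R →ₐ[R] GroupAlg R n :=
  (jmAlg R n).val.comp (MvPolynomial.aeval fun i : Fin n =>
    (⟨jm R i, Algebra.subset_adjoin ⟨i, rfl⟩⟩ : jmAlg R n))

open scoped IsMulCommutative in
@[simp]
theorem jmEval_X (R : Type*) [CommRing R] {n : ℕ} (i : Fin n) :
    jmEval R n (MvPolynomial.X i) = jm R i := by
  simp [jmEval]

/-- Multiplying out the words of `wordExpand R f` gives back the evaluation of `f`. -/
theorem lift_wordExpand (R : Type*) [CommRing R] {n : ℕ} (f : MvPolynomial (Fin n) R) :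
    MonoidAlgebra.lift R (GroupAlg R n) _
      (FreeMonoid.lift fun τ : Perm (Fin n) => MonoidAlgebra.of R _ τ) (wordExpand R f) =
      jmEval R n f := by
  have hJ : ∀ i : Fin n, MonoidAlgebra.lift R (GroupAlg R n) _
      (FreeMonoid.lift fun τ : Perm (Fin n) => MonoidAlgebra.of R _ τ) (wordJM R i) = jm R i := by
    intro i
    simp [wordJM, jm]
  conv_rhs => rw [f.as_sum]
  simp only [wordExpand, map_sum, map_smul, map_list_prod, List.map_ofFn]
  refine Finset.sum_congr rfl fun m _ => ?_
  rw [MvPolynomial.monomial_eq, ← MvPolynomial.smul_eq_C_mul, map_smul,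
    Finsupp.prod_fintype _ _ (by simp), ← List.prod_ofFn, map_list_prod, List.map_ofFn]
  congr 3
  funext i
  simp only [Function.comp_apply, map_pow, jmEval_X, hJ]

theorem closure_swap_congr {n : ℕ} (S : Set (Perm (Fin n))) (s t : Perm (Fin n)) :
    Subgroup.closure (S ∪ {s, t}) = Subgroup.closure (S ∪ {s * t * s⁻¹, s}) := by
  apply le_antisymm
  · rw [Subgroup.closure_le]
    have hs : s ∈ Subgroup.closure (S ∪ {s * t * s⁻¹, s}) :=
      Subgroup.subset_closure (by simp)
    have hst : s * t * s⁻¹ ∈ Subgroup.closure (S ∪ {s * t * s⁻¹, s}) :=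
      Subgroup.subset_closure (by simp)
    rintro x (hx | rfl | rfl)
    · exact Subgroup.subset_closure (Or.inl hx)
    · exact hs
    · have := mul_mem (mul_mem (inv_mem hs) hst) hs
      simpa [mul_assoc] using this
  · rw [Subgroup.closure_le]
    have hs : s ∈ Subgroup.closure (S ∪ {s, t}) := Subgroup.subset_closure (by simp)
    have ht : t ∈ Subgroup.closure (S ∪ {s, t}) := Subgroup.subset_closure (by simp)
    rintro x (hx | rfl | rfl)
    · exact Subgroup.subset_closure (Or.inl hx)
    · exact mul_mem (mul_mem hs ht) (inv_mem hs)
    · exact hs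

theorem transOp_hurwitz (R : Type*) [CommRing R] {n : ℕ} (s t : Perm (Fin n))
    (u v : FreeMonoid (Perm (Fin n))) :
    transOp R n (MonoidAlgebra.of R _ (u * (FreeMonoid.of s * FreeMonoid.of t) * v)) =
      transOp R n (MonoidAlgebra.of R _
        (u * (FreeMonoid.of (s * t * s⁻¹) * FreeMonoid.of s) * v)) := by
  classical
  rw [transOp_of, transOp_of]
  have h : ActsTransitively {τ | τ ∈ (u * (FreeMonoid.of s * FreeMonoid.of t) * v).toList} ↔
      ActsTransitively
        {τ | τ ∈ (u * (FreeMonoid.of (s * t * s⁻¹) * FreeMonoid.of s) * v).toList} := by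
    have e : ∀ a b : Perm (Fin n),
        {τ | τ ∈ (u * (FreeMonoid.of a * FreeMonoid.of b) * v).toList} =
          ({τ | τ ∈ u.toList} ∪ {τ | τ ∈ v.toList}) ∪ {a, b} := by
      intro a b
      ext τ
      simp [FreeMonoid.toList_mul, FreeMonoid.toList_of]
      tauto
    unfold ActsTransitively
    rw [e, e, closure_swap_congr]
  refine if_congr h ?_ rfl
  simp [FreeMonoid.toList_mul, FreeMonoid.toList_of, mul_assoc]

/-- The transitivity operator does not see the order of two neighbouring Jucys-Murphy factors. -/
theorem transOp_mul_wordJM_comm (R : Type*) [CommRing R] {n : ℕ} (i j : Fin n)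
    (x y : WordAlg R n) :
    transOp R n (x * (wordJM R i * wordJM R j) * y) =
      transOp R n (x * (wordJM R j * wordJM R i) * y) := by
  have key : ∀ i j : Fin n, i < j →
      transOp R n (x * (wordJM R i * wordJM R j) * y) =
        transOp R n (x * (wordJM R j * wordJM R i) * y) := by
    intro i j hij
    induction x using MonoidAlgebra.induction_on with
    | add a b ha hb => simp only [add_mul, map_add, ha, hb]
    | smul r a ha => simp only [smul_mul_assoc, map_smul, ha]
    | of u =>
    induction y using MonoidAlgebra.induction_on with
    | add a b ha hb => simp only [mul_add, map_add, ha, hb]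
    | smul r a ha => simp only [mul_smul_comm, map_smul, ha]
    | of v =>
    have e1 : wordJM R i * wordJM R j =
        ∑ a ∈ Finset.univ.filter (fun a : Fin n => a < i),
          ∑ b ∈ Finset.univ.filter (fun b : Fin n => b < j),
            MonoidAlgebra.of R _ (FreeMonoid.of (swap a i) * FreeMonoid.of (swap b j)) := by
      simp only [wordJM, Finset.sum_mul_sum, map_mul]
    have e2 : wordJM R j * wordJM R i =
        ∑ a ∈ Finset.univ.filter (fun a : Fin n => a < i),
          ∑ b ∈ Finset.univ.filter (fun b : Fin n => b < j),
            MonoidAlgebra.of R _ (FreeMonoid.of (swap b j) * FreeMonoid.of (swap a i)) := by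
      simp only [wordJM, Finset.sum_mul_sum, map_mul]
      rw [Finset.sum_comm]
    rw [e1, e2]
    simp only [Finset.mul_sum, Finset.sum_mul, map_sum]
    simp only [← MonoidHom.map_mul]
    refine Finset.sum_congr rfl fun a ha => ?_
    replace ha : a < i := by simpa using ha
    refine Finset.sum_equiv (swap a i) (fun b => ?_) (fun b _ => ?_)
    · simp only [Finset.mem_filter, Finset.mem_univ, true_and]
      by_cases h1 : b = a
      · subst h1; simp [hij, ha.trans hij]
      by_cases h2 : b = i
      · subst h2; simp [hij, ha.trans hij]
      rw [swap_apply_of_ne_of_ne h1 h2]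
    · rw [transOp_hurwitz]
      have h := Equiv.swap_apply_apply (swap a i) b j
      rw [swap_apply_of_ne_of_ne (ha.trans hij).ne' hij.ne'] at h
      rw [h]
  rcases lt_trichotomy i j with h | h | h
  · exact key i j h
  · rw [h]
  · exact (key j i h).symm

end

end JucysMurphy

/-!
The word `J_n ^ m` expands into the products `(a₁ n) ⋯ (aₘ n)` with `aᵢ < n`, and such a product
generates a transitive group exactly when every symbol below `n` occurs among the `aᵢ`
(`actsTransitively_image_swap_iff`).  Replace `{a | a < n}` by a finite set `A` and `n` by any
`c ∉ A`, and let `F(A, c, m)` (`starSum`) be the sum of all products `(a₁ c) ⋯ (aₘ c)` with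
`{a₁, …, aₘ} = A`.

Split off the first letter `b` of a word.  Either the other letters still exhaust `A`, or they
exhaust `A \ {b}`; in the second case conjugation by `(b c)` turns
`(b c) (a₂ c) ⋯ (aₘ c)` into `(a₂ b) ⋯ (aₘ b) (b c)`.  Hence
`F(A, c, m + 1) = (∑ b ∈ A, (b c)) F(A, c, m) + ∑ b ∈ A, F(A \ {b}, b, m) (b c)`.
The decisive point is that `F(A \ {b}, b, m)` does not depend on the choice of `b ∈ A`
(`starSum_eq_of_mem`).  With it the recursion becomes, for any `a ∈ A`,
`F(A, c, m + 1) = J (F(A, c, m) + F(A \ {a}, a, m))`, where `J = ∑ b ∈ A, (b c)` (`starSum_succ`).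

The independence is proved by induction on the cardinality of `A`.  For `A = C ∪ {b, c}` it says
that `s = (b c)` commutes with `F(C ∪ {b}, c, m)`.  Put `X = ∑ a ∈ C, (a b)` and
`Y = s + ∑ a ∈ C, (a c)`.  Two applications of the recursion, for smaller sets, give
`F(C ∪ {b}, c, m + 2) = (X + Y) F(C ∪ {b}, c, m + 1) - X Y F(C ∪ {b}, c, m) + X Y F(C \ {a}, a, m)`
for any `a ∈ C`, and `s` commutes with `X + Y`, with `X Y` and with everything supported on `C`.

For `A = {a | a < i}`, `c = i` the recursion is the one satisfied by `J_2 ⋯ J_i · h_k(J_1, …, J_i)`,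
by `h_{k+1}(x_1, …, x_i) = x_i h_k(x_1, …, x_i) + h_{k+1}(x_1, …, x_{i-1})` (`starSum_Iio`).
Finally, the powers `J_i ^ m` with `i < n` never move `n`, so that only `J_n ^ m` contributes to
the power sum, and `J_1 = 0` leaves a single term of the elementary symmetric polynomial.
-/

namespace JucysMurphy

open Equiv

/-! ### Sums over words with a prescribed set of letters -/

section SurjSum

variable {α M : Type*} [DecidableEq α]

/-- The sum of `f a₁ * ⋯ * f aₘ` over all words `a₁ ⋯ aₘ` of length `m` whose set of letters is
exactly `A`.  The recursion splits off the first letter `b`: the remaining letters form either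
`A` or `A.erase b`. -/
def surjSum [Semiring M] (f : α → M) : ℕ → Finset α → M
  | 0, A => if A = ∅ then 1 else 0
  | m + 1, A => ∑ b ∈ A, f b * (surjSum f m A + surjSum f m (A.erase b))

theorem surjSum_zero [Semiring M] (f : α → M) (A : Finset α) :
    surjSum f 0 A = if A = ∅ then 1 else 0 := rfl

theorem surjSum_succ [Semiring M] (f : α → M) (m : ℕ) (A : Finset α) :
    surjSum f (m + 1) A = ∑ b ∈ A, f b * (surjSum f m A + surjSum f m (A.erase b)) := rfl

/-- A power of a sum, expanded into words and sorted by the set of letters that occur. -/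
theorem sum_pow_eq_sum_surjSum [Semiring M] (f : α → M) (S : Finset α) (m : ℕ) :
    (∑ b ∈ S, f b) ^ m = ∑ A ∈ S.powerset, surjSum f m A := by
  induction m with
  | zero => simp [surjSum_zero]
  | succ m ih =>
    -- a subset of `S` is, for each `b`, either `A` or `A.erase b` for a unique `A` containing `b`
    have hsplit : ∀ b ∈ S, ∑ A ∈ S.powerset, surjSum f m A =
        ∑ A ∈ S.powerset with b ∈ A, (surjSum f m A + surjSum f m (A.erase b)) := by
      intro b hb
      rw [← Finset.sum_filter_add_sum_filter_not _ (b ∈ ·), Finset.sum_add_distrib]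
      congr 1
      refine Finset.sum_nbij' (insert b) (Finset.erase · b) ?_ ?_ ?_ ?_ ?_
      · intro A hA
        simp only [Finset.mem_filter, Finset.mem_powerset] at hA ⊢
        exact ⟨Finset.insert_subset hb hA.1, Finset.mem_insert_self _ _⟩
      · intro A hA
        simp only [Finset.mem_filter, Finset.mem_powerset] at hA ⊢
        exact ⟨(Finset.erase_subset _ _).trans hA.1, Finset.notMem_erase _ _⟩
      · intro A hA
        exact Finset.erase_insert (Finset.mem_filter.1 hA).2
      · intro A hA
        exact Finset.insert_erase (Finset.mem_filter.1 hA).2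
      · intro A hA
        rw [Finset.erase_insert (Finset.mem_filter.1 hA).2]
    rw [pow_succ', ih, Finset.sum_mul]
    simp only [surjSum_succ]
    rw [Finset.sum_congr rfl fun b hb => by rw [hsplit b hb, Finset.mul_sum]]
    refine Finset.sum_comm' fun b A => ?_
    simp only [Finset.mem_filter, Finset.mem_powerset]
    exact ⟨fun h => ⟨h.2.2, h.2.1⟩, fun h => ⟨h.2 h.1, h.2, h.1⟩⟩

/-- If `x` carries each `f a` to `g (σ a)` by conjugation, then it carries the sum over words with
letters `A` to the sum over words with letters `σ A`. -/
theorem mul_surjSum [Semiring M] {f g : α → M} {x : M} (σ : Perm α) {A : Finset α}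
    (h : ∀ a ∈ A, x * f a = g (σ a) * x) (m : ℕ) :
    x * surjSum f m A = surjSum g m (A.map σ.toEmbedding) * x := by
  induction m generalizing A with
  | zero => by_cases hA : A = ∅ <;> simp [surjSum_zero, hA]
  | succ m ih =>
    rw [surjSum_succ, surjSum_succ, Finset.sum_map, Finset.mul_sum, Finset.sum_mul]
    refine Finset.sum_congr rfl fun a ha => ?_
    rw [← mul_assoc, h a ha, mul_assoc, mul_assoc, mul_add, ih h,
      ih fun c hc => h c (Finset.mem_of_mem_erase hc), ← add_mul, Finset.map_erase]
    rfl

/-- The case `σ = 1` of `mul_surjSum`; with `f = g` it says that `x` commutes with the sum. -/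
theorem mul_surjSum_of_forall_mem [Semiring M] {f g : α → M} {x : M} {A : Finset α}
    (h : ∀ a ∈ A, x * f a = g a * x) (m : ℕ) :
    x * surjSum f m A = surjSum g m A * x := by
  simpa using mul_surjSum (Equiv.refl α) h m

theorem surjSum_eq_zero [Semiring M] (f : α → M) {m : ℕ} {A : Finset α} (h : m < A.card) :
    surjSum f m A = 0 := by
  induction m generalizing A with
  | zero => rw [surjSum_zero, if_neg (Finset.card_pos.1 h).ne_empty]
  | succ m ih =>
    rw [surjSum_succ]
    refine Finset.sum_eq_zero fun b hb => ?_
    have := Finset.card_erase_of_mem hb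
    rw [ih (by omega), ih (by omega), add_zero, mul_zero]

theorem map_surjSum {N F : Type*} [Semiring M] [Semiring N] [FunLike F M N] [RingHomClass F M N]
    (φ : F) (f : α → M) (m : ℕ) (A : Finset α) :
    φ (surjSum f m A) = surjSum (fun a => φ (f a)) m A := by
  induction m generalizing A with
  | zero => simp only [surjSum_zero]; split_ifs <;> simp
  | succ m ih => simp only [surjSum_succ, map_sum, map_mul, map_add, ih]

end SurjSum

/-! ### Products of transpositions sharing a symbol -/

section Star

variable (R : Type*) [CommRing R] {α : Type*} [DecidableEq α]

/-- The transposition `(b c)` in the group algebra; `c` is regarded as the centre of a star. -/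
noncomputable def starTr (c b : α) : MonoidAlgebra R (Perm α) :=
  MonoidAlgebra.of R _ (swap b c)

/-- The sum of the transpositions `(b c)` over `b ∈ A`, a Jucys-Murphy element without reference to
an order on the symbols. -/
noncomputable def starJM (c : α) (A : Finset α) : MonoidAlgebra R (Perm α) :=
  ∑ b ∈ A, starTr R c b

/-- The sum of the products `(a₁ c) ⋯ (aₘ c)` over all words `a₁ ⋯ aₘ` with set of letters `A`. -/
noncomputable def starSum (c : α) (m : ℕ) (A : Finset α) : MonoidAlgebra R (Perm α) :=
  surjSum (starTr R c) m A

theorem starTr_comm (b c : α) : starTr R c b = starTr R b c := by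
  rw [starTr, swap_comm, starTr]

theorem starTr_mul_self (b c : α) : starTr R c b * starTr R c b = 1 := by
  rw [starTr, ← map_mul, swap_mul_self, map_one]

theorem starTr_mul_starTr (a b c d : α) :
    starTr R b a * starTr R c d = starTr R (swap a b c) (swap a b d) * starTr R b a := by
  simp only [starTr, ← map_mul]
  rw [swap_apply_apply]
  simp [mul_assoc]

variable {R}

theorem starTr_mul_starJM {a b c : α} {A : Finset α} (ha : a ∈ A) (hb : b ∈ A) (hc : c ∉ A) :
    starTr R b a * starJM R c A = starJM R c A * starTr R b a := by
  rw [starJM, Finset.mul_sum, Finset.sum_mul]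
  refine Finset.sum_equiv (swap a b) (fun d => ?_) (fun d _ => ?_)
  · rw [swap_apply_def]; split_ifs <;> simp_all
  · rw [starTr_mul_starTr, swap_apply_of_ne_of_ne (a := a) (b := b) (x := c)]
    · rintro rfl; exact hc ha
    · rintro rfl; exact hc hb

theorem starTr_mul_starSum {b c : α} {A : Finset α} (hb : b ∉ A) (hc : c ∉ A) (m : ℕ) :
    starTr R c b * starSum R b m A = starSum R c m A * starTr R c b := by
  refine mul_surjSum_of_forall_mem (fun a ha => ?_) m
  rw [starTr_mul_starTr, swap_apply_left, swap_apply_of_ne_of_ne]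
  · rintro rfl; exact hb ha
  · rintro rfl; exact hc ha

theorem starJM_mul_starSum {a c : α} {A : Finset α} (ha : a ∈ A) (hc : c ∉ A) (m : ℕ) :
    starJM R c A * starSum R a m (A.erase a) = starSum R a m (A.erase a) * starJM R c A :=
  mul_surjSum_of_forall_mem
    (fun _ hd => (starTr_mul_starJM (Finset.mem_of_mem_erase hd) ha hc).symm) m

/-- The recursion for `starSum`, given that `starSum R b m (A.erase b)` is the same for all
`b ∈ A`. -/
theorem starSum_succ_of_eq {a c : α} {A : Finset α} {m : ℕ} (ha : a ∈ A) (hc : c ∉ A)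
    (h : ∀ b ∈ A, starSum R b m (A.erase b) = starSum R a m (A.erase a)) :
    starSum R c (m + 1) A = starJM R c A * (starSum R c m A + starSum R a m (A.erase a)) := by
  rw [mul_add, starJM_mul_starSum ha hc, starSum, surjSum_succ]
  simp only [mul_add, Finset.sum_add_distrib]
  rw [← Finset.sum_mul]
  congr 1
  rw [starJM, Finset.mul_sum]
  refine Finset.sum_congr rfl fun b hb => ?_
  rw [← h b hb, ← starTr_comm]
  exact starTr_mul_starSum (fun h => hc (Finset.mem_of_mem_erase h)) (Finset.notMem_erase _ _) m

theorem starJM_insert {b c : α} {C : Finset α} (hb : b ∉ C) :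
    starJM R c (insert b C) = starTr R c b + starJM R c C := by
  rw [starJM, Finset.sum_insert hb, starJM]

theorem starTr_mul_starJM_of_notMem {b c : α} {C : Finset α} (hb : b ∉ C) (hc : c ∉ C) :
    starTr R c b * starJM R b C = starJM R c C * starTr R c b := by
  rw [starJM, starJM, Finset.mul_sum, Finset.sum_mul]
  refine Finset.sum_congr rfl fun a ha => ?_
  rw [starTr_mul_starTr, swap_apply_left, swap_apply_of_ne_of_ne]
  · rintro rfl; exact hb ha
  · rintro rfl; exact hc ha

/-- For words whose letters together with the centre form the set `B`, the sum of the products does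
not depend on which element of `B` is the centre. -/
theorem starSum_eq_of_mem {b c : α} {B : Finset α} (hb : b ∈ B) (hc : c ∈ B) (m : ℕ) :
    starSum R b m (B.erase b) = starSum R c m (B.erase c) := by
  induction hn : B.card using Nat.strong_induction_on generalizing B b c m with
  | _ n ih =>
  subst hn
  rcases eq_or_ne b c with rfl | hbc
  · rfl
  obtain ⟨C, hbC, hcC, rfl⟩ : ∃ C : Finset α, b ∉ C ∧ c ∉ C ∧ B = insert c (insert b C) :=
    ⟨(B.erase c).erase b, by simp, by simp, by
      rw [Finset.insert_erase (by simp [hb, hbc]), Finset.insert_erase hc]⟩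
  have hcb : c ∉ insert b C := by simp [hcC, hbc.symm]
  have hbc' : b ∉ insert c C := by simp [hbC, hbc]
  -- Conjugation by `(b c)` exchanges the two sums, so they agree once one of them commutes with
  -- `(b c)`.
  suffices hcomm : Commute (starTr R c b) (starSum R c m (insert b C)) by
    have key : starTr R c b * starSum R b m (insert c C) =
        starSum R c m (insert b C) * starTr R c b := by
      have h := mul_surjSum (f := starTr R b) (g := starTr R c) (x := starTr R c b) (swap b c)
        (A := insert c C) (fun a _ => by rw [starTr_mul_starTr, swap_apply_left]) m
      rw [starSum, h, starSum]
      congr 2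
      rw [Finset.map_insert]
      simp only [Equiv.coe_toEmbedding, swap_apply_right]
      congr 1
      ext a
      simp only [Finset.mem_map_equiv, symm_swap]
      rw [swap_apply_def]
      split_ifs <;> simp_all
    rw [← hcomm.eq] at key
    have h2 := congrArg (starTr R c b * ·) key
    simp only [← mul_assoc, starTr_mul_self, one_mul] at h2
    rwa [Finset.erase_insert hcb, Finset.insert_comm, Finset.erase_insert hbc']
  have hcard : (insert b C).card < (insert c (insert b C)).card :=
    Finset.card_lt_card (Finset.ssubset_insert hcb)
  rcases C.eq_empty_or_nonempty with rfl | ⟨a, ha⟩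
  · exact mul_surjSum_of_forall_mem (fun d hd => by simp at hd; rw [hd]) m
  have hcard' : C.card < (insert c (insert b C)).card :=
    (Finset.card_lt_card (Finset.ssubset_insert hbC)).trans hcard
  set s := starTr R c b with hs
  set X := starJM R b C with hX
  set Y := starJM R c (insert b C) with hY
  have hss : s * s = 1 := starTr_mul_self R b c
  have hYs : Y = s + starJM R c C := starJM_insert hbC
  have hsX : s * X = Y * s - 1 := by
    rw [hYs, add_mul, hss, hX, hs, starTr_mul_starJM_of_notMem hbC hcC]
    abel
  have hsY : s * Y = X * s + 1 := by
    have h := starTr_mul_starJM_of_notMem (R := R) hcC hbC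
    rw [starTr_comm] at h
    rw [hYs, mul_add, hss, hX, hs, h]
    abel
  have hXY : X * Y = Y * X := by
    rw [hX, starJM, Finset.mul_sum, Finset.sum_mul]
    exact Finset.sum_congr rfl fun d hd => starTr_mul_starJM (by simp [hd]) (by simp) hcb
  have hsum : Commute s (X + Y) := by
    rw [commute_iff_eq, mul_add, hsX, hsY, add_mul]
    abel
  have hprod : Commute s (X * Y) := by
    rw [commute_iff_eq, ← mul_assoc, hsX, sub_mul, mul_assoc, hsY, hXY, mul_add, mul_assoc]
    simp
  have hrest : ∀ l, Commute s (starSum R a l (C.erase a)) := fun l =>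
    mul_surjSum_of_forall_mem (fun d hd => by
      have hd' := Finset.mem_of_mem_erase hd
      rw [hs, starTr_mul_starTr, swap_apply_of_ne_of_ne, swap_apply_of_ne_of_ne] <;>
        rintro rfl <;> contradiction) l
  have recB : ∀ l, starSum R c (l + 1) (insert b C) =
      Y * (starSum R c l (insert b C) + starSum R b l C) := by
    intro l
    have h := starSum_succ_of_eq (R := R) (m := l) (Finset.mem_insert_self b C) hcb
      fun d hd => ih _ hcard hd (Finset.mem_insert_self b C) l rfl
    rwa [Finset.erase_insert hbC] at h
  have recC : ∀ l, starSum R b (l + 1) C =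
      X * (starSum R b l C + starSum R a l (C.erase a)) := fun l =>
    starSum_succ_of_eq ha hbC fun d hd => ih _ hcard' hd ha l rfl
  have h0 : starSum R c 0 (insert b C) = 0 := by simp [starSum, surjSum_zero]
  have h0' : starSum R b 0 C = 0 := by
    simp [starSum, surjSum_zero, Finset.ne_empty_of_mem ha]
  induction m using Nat.twoStepInduction with
  | zero => rw [h0]; exact Commute.zero_right s
  | one => rw [recB, h0, h0']; simp
  | more l h1 h2 =>
    -- the recursions of length two and one combined, with the shorter sum over `C` eliminated
    have hrec : starSum R c (l + 2) (insert b C) = (X + Y) * starSum R c (l + 1) (insert b C) -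
        X * Y * starSum R c l (insert b C) + X * Y * starSum R a l (C.erase a) := by
      rw [recB (l + 1), recC, mul_add Y, ← mul_assoc Y X, ← hXY, add_mul, recB l]
      simp only [mul_add, mul_assoc]
      abel
    rw [hrec]
    exact ((hsum.mul_right h2).sub_right (hprod.mul_right h1)).add_right
      (hprod.mul_right (hrest l))

/-- The recursion for `starSum`; any `a ∈ A` may serve as the centre of the smaller star. -/
theorem starSum_succ {a c : α} {A : Finset α} (ha : a ∈ A) (hc : c ∉ A) (m : ℕ) :
    starSum R c (m + 1) A = starJM R c A * (starSum R c m A + starSum R a m (A.erase a)) :=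
  starSum_succ_of_eq ha hc fun _ hb => starSum_eq_of_mem hb ha m

end Star

/-! ### The transitivity operator on powers of a Jucys-Murphy element -/

section Transitivity

variable (R : Type*) [CommRing R] {n : ℕ}

/-- Transpositions `(b c)`, `b ∈ A`, act transitively iff every symbol other than `c` lies in `A`. -/
theorem actsTransitively_image_swap_iff (c : Fin n) (A : Finset (Fin n)) :
    ActsTransitively ((fun b => swap b c) '' (A : Set (Fin n))) ↔ ∀ b, b ≠ c → b ∈ A := by
  constructor
  · intro h b hbc
    by_contra hbA
    have hle : Subgroup.closure ((fun b => swap b c) '' (A : Set (Fin n))) ≤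
        MulAction.stabilizer (Perm (Fin n)) b := by
      rw [Subgroup.closure_le]
      rintro _ ⟨a, ha, rfl⟩
      exact swap_apply_of_ne_of_ne (by rintro rfl; exact hbA ha) hbc
    obtain ⟨g, hg⟩ := h.exists_smul_eq b c
    have hgb : (g : Perm (Fin n)) • b = b := hle g.2
    exact hbc (hgb.symm.trans hg)
  · intro h
    rw [ActsTransitively, MulAction.isPretransitive_iff_base c]
    intro b
    rcases eq_or_ne b c with rfl | hbc
    · exact ⟨1, one_smul _ _⟩
    · exact ⟨⟨swap b c, Subgroup.subset_closure ⟨b, h b hbc, rfl⟩⟩, swap_apply_right b c⟩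

/-- The formal sums of words in which every word has `T` as its set of letters. -/
noncomputable def wordsWithLetters (T : Set (Perm (Fin n))) : Submodule R (WordAlg R n) :=
  Submodule.span R (MonoidAlgebra.of R _ '' {w | {τ | τ ∈ w.toList} = T})

variable {R} in
theorem of_mul_mem_wordsWithLetters (τ : Perm (Fin n)) {T U : Set (Perm (Fin n))}
    (hU : insert τ T = U) {y : WordAlg R n} (hy : y ∈ wordsWithLetters R T) :
    MonoidAlgebra.of R _ (FreeMonoid.of τ) * y ∈ wordsWithLetters R U := by
  suffices h : wordsWithLetters R T ≤ (wordsWithLetters R U).comap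
      (LinearMap.mulLeft R (MonoidAlgebra.of R _ (FreeMonoid.of τ))) from h hy
  rw [wordsWithLetters, Submodule.span_le]
  rintro _ ⟨w, rfl, rfl⟩
  refine Submodule.subset_span ⟨FreeMonoid.of τ * w, ?_, by simp only [map_mul]; rfl⟩
  rw [← hU]
  ext σ
  simp [FreeMonoid.toList_mul, FreeMonoid.toList_of]

theorem surjSum_mem_wordsWithLetters {α : Type*} [DecidableEq α] (t : α → Perm (Fin n)) (m : ℕ)
    (A : Finset α) :
    surjSum (fun b => MonoidAlgebra.of R _ (FreeMonoid.of (t b))) m A ∈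
      wordsWithLetters R (t '' (A : Set α)) := by
  induction m generalizing A with
  | zero =>
    rw [surjSum_zero]
    split_ifs with hA
    · subst hA
      exact Submodule.subset_span ⟨1, by simp, map_one _⟩
    · exact zero_mem _
  | succ m ih =>
    rw [surjSum_succ]
    refine sum_mem fun b hb => ?_
    rw [mul_add]
    refine add_mem (of_mul_mem_wordsWithLetters _ ?_ (ih A))
      (of_mul_mem_wordsWithLetters _ ?_ (ih (A.erase b)))
    · exact Set.insert_eq_of_mem ⟨b, hb, rfl⟩
    · rw [← Set.image_insert_eq, ← Finset.coe_insert, Finset.insert_erase hb]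

/-- The algebra map that carries out the products in the words. -/
noncomputable def multiplyOut : WordAlg R n →ₐ[R] GroupAlg R n :=
  MonoidAlgebra.lift R (GroupAlg R n) _
    (FreeMonoid.lift fun τ : Perm (Fin n) => MonoidAlgebra.of R _ τ)

theorem multiplyOut_of (w : FreeMonoid (Perm (Fin n))) :
    multiplyOut R (MonoidAlgebra.of R _ w) = MonoidAlgebra.of R _ w.toList.prod := by
  rw [multiplyOut, MonoidAlgebra.lift_of, FreeMonoid.lift_apply, map_list_prod]

open Classical in
variable {R} in
/-- On words with a common set of letters, the transitivity operator is either zero or carries out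
the products. -/
theorem transOp_of_mem_wordsWithLetters {T : Set (Perm (Fin n))} {y : WordAlg R n}
    (hy : y ∈ wordsWithLetters R T) :
    transOp R n y = if ActsTransitively T then multiplyOut R y else 0 := by
  induction hy using Submodule.span_induction with
  | mem x hx =>
    obtain ⟨w, rfl, rfl⟩ := hx
    rw [transOp_of, multiplyOut_of]
  | zero => simp
  | add x y _ _ hx hy => rw [map_add, hx, hy]; split_ifs <;> simp
  | smul r x _ hx => rw [map_smul, hx]; split_ifs <;> simp

open Classical in
/-- A word in `J_i ^ m` is transitive iff its letters are all the transpositions `(b i)`, `b ≠ i`;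
the condition `∀ b, b ≤ i`, that `i` is the last symbol, is what makes this possible. -/
theorem transOp_wordJM_pow (i : Fin n) (m : ℕ) :
    transOp R n (wordJM R i ^ m) =
      if ∀ b, b ≤ i then starSum R i m (Finset.Iio i) else 0 := by
  have hJ : wordJM R i =
      ∑ b ∈ Finset.Iio i, MonoidAlgebra.of R _ (FreeMonoid.of (swap b i)) := by
    rw [wordJM]
    congr 1
    ext b
    simp
  have hterm : ∀ A : Finset (Fin n), transOp R n
      (surjSum (fun b => MonoidAlgebra.of R _ (FreeMonoid.of (swap b i))) m A) =
        if ∀ b, b ≠ i → b ∈ A then starSum R i m A else 0 := by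
    intro A
    rw [transOp_of_mem_wordsWithLetters (surjSum_mem_wordsWithLetters R (swap · i) m A),
      map_surjSum]
    refine if_congr (actsTransitively_image_swap_iff i A) ?_ rfl
    simp only [multiplyOut_of, FreeMonoid.toList_of, List.prod_singleton]
    rfl
  rw [hJ, sum_pow_eq_sum_surjSum, map_sum, Finset.sum_congr rfl fun A _ => hterm A,
    Finset.sum_eq_single_of_mem _ (Finset.mem_powerset_self _)]
  · refine if_congr ⟨fun h b => ?_, fun h b hb => ?_⟩ rfl rfl
    · rcases eq_or_ne b i with rfl | hb
      · exact le_rfl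
      · exact (Finset.mem_Iio.1 (h b hb)).le
    · exact Finset.mem_Iio.2 ((h b).lt_of_ne hb)
  · intro A hA hne
    refine if_neg fun h => hne ((Finset.mem_powerset.1 hA).antisymm fun b hb => ?_)
    exact h b (Finset.mem_Iio.1 hb).ne

end Transitivity

/-! ### Expansion of power sums into words -/

section WordExpand

variable (R : Type*) [CommRing R] {n : ℕ}

theorem wordExpand_eq_sum {f : MvPolynomial (Fin n) R} {s : Finset (Fin n →₀ ℕ)}
    (hs : f.support ⊆ s) :
    wordExpand R f = ∑ m ∈ s, f.coeff m • (List.ofFn fun i : Fin n => wordJM R i ^ m i).prod :=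
  Finset.sum_subset hs fun m _ hm => by rw [MvPolynomial.notMem_support_iff.1 hm, zero_smul]

theorem wordExpand_add (f g : MvPolynomial (Fin n) R) :
    wordExpand R (f + g) = wordExpand R f + wordExpand R g := by
  classical
  rw [wordExpand_eq_sum R (MvPolynomial.support_add (p := f) (q := g)),
    wordExpand_eq_sum R (f := f) Finset.subset_union_left,
    wordExpand_eq_sum R (f := g) Finset.subset_union_right, ← Finset.sum_add_distrib]
  simp only [MvPolynomial.coeff_add, add_smul]

theorem wordExpand_sum {ι : Type*} (s : Finset ι) (f : ι → MvPolynomial (Fin n) R) :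
    wordExpand R (∑ i ∈ s, f i) = ∑ i ∈ s, wordExpand R (f i) :=
  map_sum (AddMonoidHom.mk' (wordExpand R) (wordExpand_add R)) f s

theorem prod_ofFn_eq_of_forall_ne {M : Type*} [Monoid M] {f : Fin n → M} (i : Fin n)
    (h : ∀ j, j ≠ i → f j = 1) : (List.ofFn f).prod = f i := by
  induction n with
  | zero => exact i.elim0
  | succ n ih =>
    rw [List.ofFn_succ, List.prod_cons]
    refine Fin.cases ?_ (fun i => ?_) i h
    · intro h
      rw [List.prod_eq_one, mul_one]
      simp only [List.mem_ofFn', Set.mem_range]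
      rintro _ ⟨j, rfl⟩
      exact h _ (Fin.succ_ne_zero j)
    · intro h
      rw [h 0 (Fin.succ_ne_zero i).symm, one_mul]
      exact ih i fun j hj => h _ fun e => hj (Fin.succ_injective _ e)

theorem wordExpand_X_pow (i : Fin n) (m : ℕ) :
    wordExpand R (MvPolynomial.X i ^ m) = wordJM R i ^ m := by
  classical
  rw [MvPolynomial.X_pow_eq_monomial, wordExpand_eq_sum R MvPolynomial.support_monomial_subset,
    Finset.sum_singleton, MvPolynomial.coeff_monomial, if_pos rfl, one_smul,
    prod_ofFn_eq_of_forall_ne i fun j hj => by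
      rw [Finsupp.single_eq_of_ne hj, pow_zero], Finsupp.single_eq_same]

theorem transEval_psum (m : ℕ) :
    transEval R (MvPolynomial.psum (Fin n) R m) = ∑ i, transOp R n (wordJM R i ^ m) := by
  rw [transEval, MvPolynomial.psum, wordExpand_sum, map_sum]
  simp only [wordExpand_X_pow]

end WordExpand

/-! ### Complete homogeneous and elementary symmetric polynomials -/

section SymmetricPolynomials

variable (R : Type*) [CommRing R]

/-- A multiset of size `k + 1` in `Option σ` either contains `none` or lives on `σ`. -/
theorem hsymm_option_succ (σ : Type*) [Fintype σ] [DecidableEq σ] (k : ℕ) :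
    MvPolynomial.hsymm (Option σ) R (k + 1) =
      MvPolynomial.X none * MvPolynomial.hsymm (Option σ) R k +
        MvPolynomial.rename some (MvPolynomial.hsymm σ R (k + 1)) := by
  simp only [MvPolynomial.hsymm]
  rw [← Equiv.sum_comp symOptionSuccEquiv.symm, Fintype.sum_sum_type, Finset.mul_sum, map_sum]
  congr 1
  · refine Finset.sum_congr rfl fun s _ => ?_
    change (Multiset.map _ (none ::ₛ s : Sym (Option σ) (k + 1)).1).prod = _
    rw [Sym.val_eq_coe, Sym.coe_cons, Multiset.map_cons, Multiset.prod_cons]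
    rfl
  · refine Finset.sum_congr rfl fun s _ => ?_
    change (Multiset.map _ (s.1.map some)).prod = _
    rw [map_multiset_prod, Multiset.map_map, Multiset.map_map]
    simp

theorem hsymm_fin_succ (i k : ℕ) :
    MvPolynomial.hsymm (Fin (i + 1)) R (k + 1) =
      MvPolynomial.X (Fin.last i) * MvPolynomial.hsymm (Fin (i + 1)) R k +
        MvPolynomial.rename Fin.castSucc (MvPolynomial.hsymm (Fin i) R (k + 1)) := by
  have h := congrArg (MvPolynomial.rename (finSuccEquivLast (n := i)).symm)
    (hsymm_option_succ R (Fin i) k)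
  rw [map_add, map_mul, MvPolynomial.rename_hsymm, MvPolynomial.rename_hsymm,
    MvPolynomial.rename_X, MvPolynomial.rename_rename, finSuccEquivLast_symm_none] at h
  rw [h]
  congr 3
  funext j
  simp

variable {n : ℕ}

theorem jm_eq_starJM (i : Fin n) : jm R i = starJM R i (Finset.Iio i) := by
  rw [jm, starJM]
  refine Finset.sum_congr ?_ fun _ _ => rfl
  ext b
  simp

/-- The products `(a₁ i) ⋯ (aₘ i)` whose letters are all the symbols below `i` add up to a symmetric
polynomial in the Jucys-Murphy elements of the symbols up to `i`. -/
theorem starSum_Iio (i : ℕ) (hi : i < n) (k : ℕ) :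
    starSum R (⟨i, hi⟩ : Fin n) (i + k) (Finset.Iio ⟨i, hi⟩) =
      jmEval R n ((∏ j : Fin i, MvPolynomial.X (⟨j + 1, by omega⟩ : Fin n)) *
        MvPolynomial.rename (Fin.castLE hi) (MvPolynomial.hsymm (Fin (i + 1)) R k)) := by
  induction i generalizing k with
  | zero =>
    have hempty : Finset.Iio (⟨0, hi⟩ : Fin n) = ∅ := by
      ext b
      simp [Fin.lt_def]
    rw [hempty, Finset.univ_eq_empty, Finset.prod_empty, one_mul]
    cases k with
    | zero => simp [starSum, surjSum_zero]
    | succ k =>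
      rw [starSum, zero_add, surjSum_succ, Finset.sum_empty, hsymm_fin_succ, map_add, map_mul,
        MvPolynomial.rename_X, map_add, map_mul, jmEval_X]
      have h0 : jm R (Fin.castLE hi (Fin.last 0)) = 0 := by
        rw [jm_eq_starJM]
        exact (congrArg (starJM R _) hempty).trans Finset.sum_empty
      have h1 : MvPolynomial.hsymm (Fin 0) R (k + 1) = 0 := by simp [MvPolynomial.hsymm]
      rw [h0, h1]
      simp
  | succ i ih =>
    have hi' : i < n := by omega
    have hmem : (⟨i, hi'⟩ : Fin n) ∈ Finset.Iio (⟨i + 1, hi⟩ : Fin n) := by simp [Fin.lt_def]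
    have herase : (Finset.Iio (⟨i + 1, hi⟩ : Fin n)).erase ⟨i, hi'⟩ = Finset.Iio ⟨i, hi'⟩ := by
      ext b
      simp only [Finset.mem_erase, Finset.mem_Iio, Fin.lt_def, ne_eq, Fin.ext_iff]
      omega
    have hrec : ∀ m, starSum R (⟨i + 1, hi⟩ : Fin n) (m + 1) (Finset.Iio ⟨i + 1, hi⟩) =
        jm R ⟨i + 1, hi⟩ * (starSum R ⟨i + 1, hi⟩ m (Finset.Iio ⟨i + 1, hi⟩) +
          starSum R ⟨i, hi'⟩ m (Finset.Iio ⟨i, hi'⟩)) := by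
      intro m
      rw [starSum_succ hmem (by simp), herase, jm_eq_starJM]
    rw [Fin.prod_univ_castSucc]
    simp only [Fin.val_castSucc, Fin.val_last]
    induction k with
    | zero =>
      have hzero : starSum R (⟨i + 1, hi⟩ : Fin n) i (Finset.Iio ⟨i + 1, hi⟩) = 0 :=
        surjSum_eq_zero _ (by simp)
      have hprev := ih hi' 0
      rw [add_zero] at hprev
      rw [add_zero, hrec, hzero, hprev, zero_add, ← jmEval_X, ← map_mul,
        MvPolynomial.hsymm_zero, MvPolynomial.hsymm_zero, map_one, map_one]
      congr 1
      ring
    | succ k ihk =>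
      rw [← add_assoc, hrec, ihk, add_right_comm i 1 k, add_assoc i k 1, ih hi', ← jmEval_X,
        ← map_add, ← map_mul, hsymm_fin_succ R (i + 1), map_add (MvPolynomial.rename _),
        map_mul (MvPolynomial.rename _), MvPolynomial.rename_X, MvPolynomial.rename_rename]
      have key : ∀ x p h r : MvPolynomial (Fin n) R,
          x * (p * x * h + p * r) = p * x * (x * h + r) := fun x p h r => by ring
      exact congrArg _ (key _ _ _ _)

/-- Since the Jucys-Murphy element at the first symbol vanishes, the only surviving term of the
elementary symmetric polynomial is the one that avoids it. -/
theorem jmEval_esymm_succ (N : ℕ) :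
    jmEval R (N + 1) (MvPolynomial.esymm (Fin (N + 1)) R N) =
      jmEval R (N + 1) (∏ j : Fin N, MvPolynomial.X j.succ) := by
  have h0 : jm R (0 : Fin (N + 1)) = 0 := by
    rw [jm_eq_starJM, starJM, Finset.sum_eq_zero]
    intro b hb
    simp at hb
  have himage : (Finset.univ.image Fin.succ : Finset (Fin (N + 1))).card = N := by
    rw [Finset.card_image_of_injective _ (Fin.succ_injective N), Finset.card_univ,
      Fintype.card_fin]
  rw [MvPolynomial.esymm, map_sum,
    Finset.sum_eq_single_of_mem (Finset.univ.image Fin.succ)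
      (Finset.mem_powersetCard.2 ⟨Finset.subset_univ _, himage⟩),
    Finset.prod_image fun _ _ _ _ h => Fin.succ_injective N h]
  intro t ht hne
  have hcard := (Finset.mem_powersetCard.1 ht).2
  have hmem : (0 : Fin (N + 1)) ∈ t := by
    by_contra hmem
    refine hne (Finset.eq_of_subset_of_card_le (fun a ha => ?_) (by rw [himage, hcard]))
    obtain ⟨j, rfl⟩ := Fin.exists_succ_eq_of_ne_zero (show a ≠ 0 by rintro rfl; exact hmem ha)
    exact Finset.mem_image_of_mem _ (Finset.mem_univ j)
  rw [← Finset.mul_prod_erase t _ hmem, map_mul, jmEval_X, h0, zero_mul]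

theorem prod_ofFn_jm_succ (N : ℕ) :
    (List.ofFn fun i : Fin N => jm R i.succ).prod =
      jmEval R (N + 1) (∏ j : Fin N, MvPolynomial.X j.succ) := by
  rw [← List.prod_ofFn, map_list_prod, List.map_ofFn]
  congr 2
  funext i
  simp

end SymmetricPolynomials

end JucysMurphy

open JucysMurphy in
theorem corollary1p5 (R : Type*) [CommRing R] (n k : ℕ) (hn : 2 ≤ n) :
    transEval R (MvPolynomial.psum (Fin n) R (n - 1 + k)) =
        transOp R n (wordJM R (⟨n - 1, by omega⟩ : Fin n) ^ (n - 1 + k)) ∧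
      transOp R n (wordJM R (⟨n - 1, by omega⟩ : Fin n) ^ (n - 1 + k)) =
        (List.ofFn fun i : Fin (n - 1) => jm R (⟨i + 1, by omega⟩ : Fin n)).prod *
          jmEval R n (MvPolynomial.hsymm (Fin n) R k) ∧
      (List.ofFn fun i : Fin (n - 1) => jm R (⟨i + 1, by omega⟩ : Fin n)).prod *
          jmEval R n (MvPolynomial.hsymm (Fin n) R k) =
        jmEval R n (MvPolynomial.esymm (Fin n) R (n - 1)) *
          jmEval R n (MvPolynomial.hsymm (Fin n) R k) := by
  obtain ⟨N, rfl⟩ : ∃ N, n = N + 1 := ⟨n - 1, by omega⟩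
  have hprod : (List.ofFn fun i : Fin (N + 1 - 1) =>
      jm R (⟨i + 1, by omega⟩ : Fin (N + 1))).prod =
        jmEval R (N + 1) (∏ j : Fin N, MvPolynomial.X j.succ) := prod_ofFn_jm_succ R N
  refine ⟨?_, ?_, ?_⟩
  · -- a power of `J_i` contributes only if `i` is the last symbol
    rw [transEval_psum]
    refine Finset.sum_eq_single_of_mem _ (Finset.mem_univ _) fun i _ hi => ?_
    rw [transOp_wordJM_pow, if_neg fun h => hi ?_]
    have := h (Fin.last N)
    exact Fin.last_le_iff.1 this
  · rw [hprod, ← map_mul]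
    refine (transOp_wordJM_pow R _ _).trans ((if_pos fun b => Fin.le_last b).trans ?_)
    refine (starSum_Iio R N (Nat.lt_succ_self N) k).trans ?_
    have e : Fin.castLE (Nat.lt_succ_self N) = (id : Fin (N + 1) → Fin (N + 1)) := rfl
    rw [e, MvPolynomial.rename_id_apply]
    rfl
  · rw [hprod, ← jmEval_esymm_succ]
    rfl
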